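/- **Theorem (region counting formula for arrangements of tropical hypersurfaces).** A *tropical signomial* on $\mathbb{R}^d$ is a finite nonempty tropical sum of monomials, $g=\bigoplus_{j} c_j\odot x^{\odot a_j}$ with $a_j\in\mathbb{R}^d$ and $c_j\in\mathbb{R}$; it defines the function $g(x)=\max_j(\langle a_j,x\rangle+c_j)$. The tropical product $g\odot h$ is obtained by multiplying out, and defines the sum of the two functions. A monomial is redundant if removing it does not change the function; the *monomial length* $\mathrm{mlen}(g)$ is the number of monomials left in the reduced form of $g$, in which the redundant monomials are removed. The *tropical hypersurface* $\mathcal V(g)\subset\mathbb{R}^d$ is the set of points at which the maximum is attained by at least two different monomials of $g$. For a finite polyhedral complex $K$ in $\mathbb{R}^d$ (whose cells are polyhedra, bounded or unbounded) put $\chi(K)=\sum_{\emptyset\neq\sigma\in K}(-1)^{\dim\sigma}$. Let $g_1,\dots,g_m$ be tropical signomials on $\mathbb{R}^d$, and let $$\mathrm{flen}(g_1\odot\cdots\odot g_m)=\sum_{i=1}^m\mathrm{mlen}(g_i)-(m-1)$$ be the factorization length of their product. Then: 1. The number of regions of the arrangement, that is, of connected components of $\mathbb{R}^d\setminus\bigcup_{i=1}^m\mathcal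 V(g_i)$, is $\mathrm{mlen}(g_1\odot\cdots\odot g_m)$. 2. For every nonempty $S\subseteq[m]$ the set $\bigcap_{i\in S}\mathcal V(g_i)$ is the union of the cells of a finite polyhedral complex, and $$\mathrm{mlen}(g_1\odot\cdots\odot g_m)=\mathrm{flen}(g_1\odot\cdots\odot g_m)+\sum_{k=2}^m(-1)^{k+d}\sum_{\substack{S\subseteq[m]\\|S|=k}}\chi\Bigl(\bigcap_{i\in S}\mathcal V(g_i)\Bigr),$$ where $\chi\bigl(\bigcap_{i\in S}\mathcal V(g_i)\bigr)$ may be computed as $\chi(K_S)$ from any finite polyhedral complex $K_S$ with union $\bigcap_{i\in S}\mathcal V(g_i)$. -/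

import Mathlib

open scoped Pointwise

noncomputable section

/-- A tropical signomial in `d` variables, in the max-plus convention: a formal tropical sum of
finitely many (and at least one) monomials. The pair `(a, c)` stands for the monomial
`c ⊙ x₁^{⊙ a₁} ⊙ ⋯ ⊙ x_d^{⊙ a_d}`, that is, for the function `x ↦ a₁ x₁ + ⋯ + a_d x_d + c`;
exponents and coefficients are arbitrary reals. -/
@[ext]
structure TropicalSignomial (d : ℕ) where
  terms : Finset ((Fin d → ℝ) × ℝ)
  nonempty : terms.Nonempty

namespace TropicalSignomial

variable {d : ℕ}

/-- The value at `x` of the monomial with exponent vector `t.1` and coefficient `t.2`. -/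
def termEval (t : (Fin d → ℝ) × ℝ) (x : Fin d → ℝ) : ℝ := t.1 ⬝ᵥ x + t.2

/-- The real-valued function defined by a tropical signomial: the maximum of its monomials. -/
def eval (g : TropicalSignomial d) (x : Fin d → ℝ) : ℝ :=
  g.terms.sup' g.nonempty fun t => termEval t x

/-- The tropical product `⊙`, multiplied out by distributivity: its monomials are the tropical
products of a monomial of `g` and a monomial of `h` (exponents and coefficients add up). -/
instance : Mul (TropicalSignomial d) where
  mul g h := ⟨g.terms + h.terms, g.nonempty.add h.nonempty⟩

/-- The tropical unit, the constant `0`. -/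
instance : One (TropicalSignomial d) where
  one := ⟨0, Finset.zero_nonempty⟩

instance : CommMonoid (TropicalSignomial d) where
  mul_assoc f g h := TropicalSignomial.ext (add_assoc f.terms g.terms h.terms)
  one_mul g := TropicalSignomial.ext (zero_add g.terms)
  mul_one g := TropicalSignomial.ext (add_zero g.terms)
  mul_comm g h := TropicalSignomial.ext (add_comm g.terms h.terms)

/-- The monomial `t` of `g` is redundant if removing it leaves a tropical signomial that defines
the same function. -/
def IsRedundant (g : TropicalSignomial d) (t : (Fin d → ℝ) × ℝ) : Prop :=
  ∃ h : (g.terms.erase t).Nonempty, ∀ x, eval ⟨g.terms.erase t, h⟩ x = g.eval x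

open Classical in
/-- The monomial length: the number of monomials that are left in the reduced form of `g`, where
the redundant monomials are removed. -/
def mlen (g : TropicalSignomial d) : ℕ := (g.terms.filter fun t => ¬ g.IsRedundant t).card

/-- The factorization length of the product `g₁ ⊙ ⋯ ⊙ g_m`. -/
def flen {m : ℕ} (g : Fin m → TropicalSignomial d) : ℤ :=
  ∑ i, ((g i).mlen : ℤ) - ((m : ℤ) - 1)

/-- The tropical hypersurface `𝒱(g)`: the points where the maximum is attained by at least two
monomials. -/
def hypersurface (g : TropicalSignomial d) : Set (Fin d → ℝ) :=
  {x | ∃ s ∈ g.terms, ∃ t ∈ g.terms, s ≠ t ∧ termEval s x = g.eval x ∧ termEval t x = g.eval x}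

end TropicalSignomial

/-- A polyhedron in `ℝ^d`: the intersection of finitely many closed half-spaces. -/
def IsPolyhedron {d : ℕ} (P : Set (Fin d → ℝ)) : Prop :=
  ∃ H : Finset ((Fin d → ℝ) × ℝ), P = {x | ∀ p ∈ H, p.1 ⬝ᵥ x ≤ p.2}

/-- A finite polyhedral complex in `ℝ^d`: finitely many nonempty polyhedra, possibly unbounded,
such that each nonempty face of a cell is a cell and any two cells meet in a common face (possibly
the empty one). `IsExposed ℝ σ τ` says that `τ` is empty or the locus where some linear functional
attains its maximum over `σ`, that is, for a polyhedron `σ`, that `τ` is a face of `σ`. -/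
structure PolyhedralComplex (d : ℕ) where
  cells : Finset (Set (Fin d → ℝ))
  cell_nonempty : ∀ σ ∈ cells, σ.Nonempty
  cell_isPolyhedron : ∀ σ ∈ cells, IsPolyhedron σ
  face_mem : ∀ σ ∈ cells, ∀ τ : Set (Fin d → ℝ), τ.Nonempty → IsExposed ℝ σ τ → τ ∈ cells
  inter_isFace : ∀ σ ∈ cells, ∀ τ ∈ cells, IsExposed ℝ σ (σ ∩ τ) ∧ IsExposed ℝ τ (σ ∩ τ)

namespace PolyhedralComplex

variable {d : ℕ}

/-- The underlying set of a polyhedral complex: the union of its cells. -/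
def support (K : PolyhedralComplex d) : Set (Fin d → ℝ) := ⋃ σ ∈ K.cells, σ

/-- The Euler characteristic of a polyhedral complex: the alternating sum of the numbers of cells
(bounded or not) in the different dimensions. The dimension of a cell is that of its affine
span. -/
def eulerChar (K : PolyhedralComplex d) : ℤ :=
  ∑ σ ∈ K.cells, (-1) ^ Module.finrank ℝ (vectorSpan ℝ σ)

end PolyhedralComplex

end

/-! The Euler characteristic is a valuation. Every integral linear relation between indicator
functions of nonempty relatively open convex sets survives when the indicator of `U` is replaced by
`(-1) ^ dim U` (`sum_mul_neg_one_pow_finrank_eq_zero`). Hence χ is a well-defined additive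
functional on the span of these indicators: `eulerGraph` is its graph, and `eq_of_mem_eulerGraph`
says that the graph is single-valued. The relation is proved by induction on the dimension. A linear
functional `l` cuts the sets into fibres, and `dim U` is the dimension of `l '' U` plus that of any
nonempty fibre, so everything reduces to the fibres and to the line. On the line, χ is the total
one-sided jump of the indicator minus its value near `-∞`, which is visibly additive.

A polyhedral complex is the disjoint union of the relative interiors of its cells, so its
alternating cell count is χ of its support and depends on nothing else. The complement of `𝒱(g)` is
the disjoint union of open convex regions, one for each non-redundant monomial. This counts the
components and gives `χ(𝒱(g)) = (-1) ^ d * (1 - mlen g)`.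

The hypersurface of a product is the union of the hypersurfaces of the factors, so
inclusion-exclusion computes χ of it a second time. The singletons contribute `(-1) ^ d * (m - ∑
mlen gᵢ)`, and comparing the two values gives the formula. The required complexes exist because each
`𝒱(gᵢ)` is a union of cells of the subdivision into domains of linearity of the product. -/

/-! ### Relatively open convex sets, their linear images and fibres -/

/-- A relatively open convex set, in algebraic form: a convex set in which every segment can be
prolonged a little beyond each of its end points. -/
structure IsRelOpenConvex {E : Type*} [AddCommGroup E] [Module ℝ E] (U : Set E) : Prop where
  convex : Convex ℝ U
  exists_add_smul_mem : ∀ x ∈ U, ∀ y ∈ U, ∃ ε : ℝ, 0 < ε ∧ x + ε • (x - y) ∈ U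

namespace IsRelOpenConvex

variable {E F : Type*} [AddCommGroup E] [Module ℝ E] [AddCommGroup F] [Module ℝ F] {U : Set E}

theorem image (hU : IsRelOpenConvex U) (l : E →ₗ[ℝ] F) : IsRelOpenConvex (l '' U) := by
  refine ⟨hU.convex.linear_image l, ?_⟩
  rintro _ ⟨x, hx, rfl⟩ _ ⟨y, hy, rfl⟩
  obtain ⟨ε, hε, h⟩ := hU.exists_add_smul_mem x hx y hy
  exact ⟨ε, hε, _, h, by simp⟩

theorem inter_fiber (hU : IsRelOpenConvex U) (l : E →ₗ[ℝ] ℝ) (a : ℝ) :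
    IsRelOpenConvex (U ∩ l ⁻¹' {a}) := by
  refine ⟨hU.convex.inter ((convex_singleton a).linear_preimage l), ?_⟩
  rintro x ⟨hx, rfl⟩ y ⟨hy, hxy⟩
  obtain ⟨ε, hε, h⟩ := hU.exists_add_smul_mem x hx y hy
  refine ⟨ε, hε, h, ?_⟩
  have hxy : l y = l x := hxy
  simp [hxy]

theorem add_smul_mem_of_le (hU : Convex ℝ U) {x v : E} (hx : x ∈ U) {ε δ : ℝ} (hδ : 0 ≤ δ)
    (hδε : δ ≤ ε) (h : x + ε • v ∈ U) : x + δ • v ∈ U := by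
  rcases hδ.eq_or_lt with rfl | hδ'
  · simpa using hx
  have hε : 0 < ε := hδ'.trans_le hδε
  have := hU.add_smul_mem hx h (t := δ / ε) ⟨by positivity, (div_le_one hε).2 hδε⟩
  rwa [smul_smul, div_mul_cancel₀ _ hε.ne'] at this

theorem exists_add_smul_mem_of_mem_vectorSpan (hU : IsRelOpenConvex U) {x v : E} (hx : x ∈ U)
    (hv : v ∈ vectorSpan ℝ U) : ∃ ε : ℝ, 0 < ε ∧ x + ε • v ∈ U := by
  -- Both signs of `v` are carried along so that the induction passes through negative scalars.
  have key : ∀ v ∈ vectorSpan ℝ U,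
      ∃ ε : ℝ, 0 < ε ∧ x + ε • v ∈ U ∧ x + ε • (-v) ∈ U := by
    intro v hv
    rw [vectorSpan_eq_span_vsub_set_right ℝ hx] at hv
    induction hv using Submodule.span_induction with
    | mem v hv =>
      obtain ⟨y, hy, rfl⟩ := hv
      obtain ⟨ε, hε, h⟩ := hU.exists_add_smul_mem x hx y hy
      refine ⟨min ε 1, by positivity, ?_, ?_⟩
      · exact add_smul_mem_of_le hU.convex hx (by positivity) (min_le_right _ _)
          (by simpa using hy)
      · refine add_smul_mem_of_le hU.convex hx (by positivity) (min_le_left _ _) ?_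
        simpa using h
    | zero => exact ⟨1, one_pos, by simpa using hx, by simpa using hx⟩
    | add v w _ _ hv hw =>
      obtain ⟨ε, hε, h1, h2⟩ := hv
      obtain ⟨δ, hδ, h3, h4⟩ := hw
      have hm : 0 < min ε δ := by positivity
      refine ⟨min ε δ / 2, by positivity, ?_, ?_⟩
      · convert hU.convex.midpoint_mem
          (add_smul_mem_of_le hU.convex hx hm.le (min_le_left _ _) h1)
          (add_smul_mem_of_le hU.convex hx hm.le (min_le_right _ _) h3) using 1
        rw [midpoint_eq_smul_add, invOf_eq_inv]
        module
      · convert hU.convex.midpoint_mem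
          (add_smul_mem_of_le hU.convex hx hm.le (min_le_left _ _) h2)
          (add_smul_mem_of_le hU.convex hx hm.le (min_le_right _ _) h4) using 1
        rw [midpoint_eq_smul_add, invOf_eq_inv]
        module
    | smul a v _ hv =>
      obtain ⟨ε, hε, h1, h2⟩ := hv
      rcases lt_trichotomy a 0 with ha | rfl | ha
      · have ha' : a ≠ 0 := ha.ne
        refine ⟨ε / (-a), div_pos hε (by linarith), ?_, ?_⟩
        · convert h2 using 2
          rw [smul_smul, smul_neg, ← neg_smul]; congr 1; field_simp
        · convert h1 using 2
          rw [smul_neg, smul_smul, ← neg_smul]; congr 1; field_simp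
      · exact ⟨1, one_pos, by simpa using hx, by simpa using hx⟩
      · refine ⟨ε / a, by positivity, ?_, ?_⟩
        · convert h1 using 2
          rw [smul_smul, div_mul_cancel₀ _ ha.ne']
        · convert h2 using 2
          rw [smul_neg, smul_neg, smul_smul, div_mul_cancel₀ _ ha.ne']
  obtain ⟨ε, hε, h, -⟩ := key v hv
  exact ⟨ε, hε, h⟩

/-- A short move from a point of the fibre along a direction of `U` killed by `l` stays in `U` and
in the fibre. Relative openness matters: a closed set may touch a fibre only in a face of too small
dimension. -/
theorem vectorSpan_inter_fiber (hU : IsRelOpenConvex U) (l : E →ₗ[ℝ] ℝ) {a : ℝ}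
    (ha : (U ∩ l ⁻¹' {a}).Nonempty) :
    vectorSpan ℝ (U ∩ l ⁻¹' {a}) = vectorSpan ℝ U ⊓ LinearMap.ker l := by
  apply le_antisymm
  · refine le_inf (vectorSpan_mono ℝ Set.inter_subset_left) ?_
    rw [vectorSpan_def, Submodule.span_le]
    rintro _ ⟨x, ⟨-, hx⟩, y, ⟨-, hy⟩, rfl⟩
    have hx : l x = a := hx
    have hy : l y = a := hy
    simp [hx, hy]
  · rintro v ⟨hv, hlv⟩
    obtain ⟨x, hx, hxa⟩ := ha
    obtain ⟨ε, hε, h⟩ := hU.exists_add_smul_mem_of_mem_vectorSpan hx hv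
    have hlv : l v = 0 := hlv
    have hxa : l x = a := hxa
    have h' : x + ε • v ∈ U ∩ l ⁻¹' {a} := ⟨h, by simp [hlv, hxa]⟩
    have := vsub_mem_vectorSpan ℝ h' ⟨hx, hxa⟩
    rw [vsub_eq_sub, add_sub_cancel_left] at this
    simpa [smul_smul, inv_mul_cancel₀ hε.ne'] using Submodule.smul_mem _ ε⁻¹ this

end IsRelOpenConvex

theorem LinearMap.finrank_map_add_finrank_inf_ker {E F : Type*} [AddCommGroup E] [Module ℝ E]
    [FiniteDimensional ℝ E] [AddCommGroup F] [Module ℝ F] (l : E →ₗ[ℝ] F) (W : Submodule ℝ E) :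
    Module.finrank ℝ (W.map l) + Module.finrank ℝ ↥(W ⊓ LinearMap.ker l) = Module.finrank ℝ W := by
  have h := LinearMap.finrank_range_add_finrank_ker (l ∘ₗ W.subtype)
  rw [LinearMap.range_comp, Submodule.range_subtype, LinearMap.ker_comp] at h
  rw [← h, ← Submodule.map_comap_subtype, Submodule.finrank_map_subtype_eq]

/-- Rank-nullity for `l` on the direction space of `U`; all nonempty fibres have the same dimension.
-/
theorem IsRelOpenConvex.finrank_inter_fiber {E : Type*} [AddCommGroup E] [Module ℝ E]
    [FiniteDimensional ℝ E] {U : Set E} (hU : IsRelOpenConvex U) (l : E →ₗ[ℝ] ℝ) {a : ℝ}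
    (ha : (U ∩ l ⁻¹' {a}).Nonempty) :
    Module.finrank ℝ (vectorSpan ℝ (l '' U)) + Module.finrank ℝ (vectorSpan ℝ (U ∩ l ⁻¹' {a})) =
      Module.finrank ℝ (vectorSpan ℝ U) := by
  rw [hU.vectorSpan_inter_fiber l ha, ← l.finrank_map_add_finrank_inf_ker (vectorSpan ℝ U)]
  have h : (vectorSpan ℝ U).map l = vectorSpan ℝ (l '' U) := l.toAffineMap.map_vectorSpan
  rw [h]

/-! ### The Euler relation on the line -/

section Line

open Filter Topology Set

theorem IsRelOpenConvex.eq_singleton_or_isOpen {I : Set ℝ} (hI : IsRelOpenConvex I)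
    (hne : I.Nonempty) : (∃ p, I = {p}) ∨ (IsOpen I ∧ vectorSpan ℝ I = ⊤) := by
  by_cases hs : I.Subsingleton
  · left
    obtain ⟨p, hp⟩ := hne
    exact ⟨p, hs.eq_singleton_of_mem hp⟩
  right
  obtain ⟨x, hx, y, hy, hxy⟩ := not_subsingleton_iff.1 hs
  have htop : vectorSpan ℝ I = ⊤ := by
    rw [eq_top_iff]
    intro v _
    have h := vsub_mem_vectorSpan ℝ hx hy
    have := Submodule.smul_mem _ (v / (x - y)) h
    rwa [vsub_eq_sub, smul_eq_mul, div_mul_cancel₀ _ (sub_ne_zero.2 hxy)] at this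
  refine ⟨isOpen_iff_mem_nhds.2 fun z hz => ?_, htop⟩
  obtain ⟨ε, hε, h1⟩ := hI.exists_add_smul_mem_of_mem_vectorSpan hz (v := 1) (htop ▸ trivial)
  obtain ⟨δ, hδ, h2⟩ := hI.exists_add_smul_mem_of_mem_vectorSpan hz (v := -1) (htop ▸ trivial)
  refine mem_of_superset (Icc_mem_nhds (a := z + δ • (-1)) (b := z + ε • 1) ?_ ?_)
    (hI.convex.ordConnected.out h2 h1)
  · simpa using hδ
  · simpa using hε

/-- For a nonempty relatively open convex subset `I` of the line with indicator function `f`,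
the jump `f x - f (x + 0)` is `1` if `I = {x}`, `-1` if `x` is the left end point of an open
interval `I`, and `0` otherwise. -/
theorem IsRelOpenConvex.exists_jump {I : Set ℝ} (hI : IsRelOpenConvex I) (hne : I.Nonempty) :
    ∃ (p : ℝ) (u : ℤ), (∀ x, ∀ᶠ ε in 𝓝[>] (0 : ℝ),
        indicator I (1 : ℝ → ℤ) x - indicator I 1 (x + ε) = if x = p then u else 0) ∧
      (∀ᶠ M in atBot, indicator I (1 : ℝ → ℤ) M = u - (-1) ^ Module.finrank ℝ (vectorSpan ℝ I)) := by
  have hpos : ∀ᶠ ε in 𝓝[>] (0 : ℝ), 0 < ε := eventually_mem_nhdsWithin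
  have hlt : ∀ {a : ℝ}, 0 < a → ∀ᶠ ε in 𝓝[>] (0 : ℝ), ε < a := fun ha =>
    nhdsWithin_le_nhds (eventually_lt_nhds ha)
  rcases hI.eq_singleton_or_isOpen hne with ⟨p, rfl⟩ | ⟨ho, htop⟩
  · refine ⟨p, 1, fun x => ?_, ?_⟩
    · rcases lt_trichotomy x p with h | rfl | h
      · filter_upwards [hlt (sub_pos.2 h)] with ε hε
        have : x + ε ≠ p := by linarith
        simp [h.ne, this]
      · filter_upwards [hpos] with ε hε
        simp [hε.ne']
      · filter_upwards [hpos] with ε hε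
        have : x + ε ≠ p := by linarith
        simp [h.ne', this]
    · filter_upwards [eventually_lt_atBot p] with M hM
      rw [vectorSpan_singleton, finrank_bot]
      simp [hM.ne]
  · have hdim : Module.finrank ℝ (vectorSpan ℝ I) = 1 := by
      rw [htop, finrank_top, Module.finrank_self]
    have hin : ∀ x ∈ I, ∀ᶠ ε in 𝓝[>] (0 : ℝ), x + ε ∈ I := by
      intro x hx
      have ht : Tendsto (fun ε : ℝ => x + ε) (𝓝[>] 0) (𝓝 x) := by
        have : Tendsto (fun ε : ℝ => x + ε) (𝓝 0) (𝓝 (x + 0)) :=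
          (continuous_const.add continuous_id).tendsto 0
        rw [add_zero] at this
        exact this.mono_left nhdsWithin_le_nhds
      exact ht (ho.mem_nhds hx)
    have hoc := hI.convex.ordConnected
    obtain ⟨y, hy⟩ := hne
    -- Only the left end is seen by a jump to the right: the right end point of an open interval is
    -- already outside it.
    have hmono : ∀ x, (∃ z ∈ I, z ≤ x) → ∀ᶠ ε in 𝓝[>] (0 : ℝ),
        indicator I (1 : ℝ → ℤ) x - indicator I 1 (x + ε) = 0 := by
      rintro x ⟨z, hz, hzx⟩
      by_cases hx : x ∈ I
      · filter_upwards [hin x hx] with ε hε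
        simp [hx, hε]
      · filter_upwards [hpos] with ε hε
        have : x + ε ∉ I := fun h => hx (hoc.out hz h ⟨hzx, by linarith⟩)
        simp [hx, this]
    by_cases hb : BddBelow I
    · have hinf := Real.isGLB_sInf ⟨y, hy⟩ hb
      refine ⟨sInf I, -1, fun x => ?_, ?_⟩
      · split_ifs with h
        · subst h
          have hnot : sInf I ∉ I := by
            intro h
            obtain ⟨ε, hε, h1⟩ := hI.exists_add_smul_mem_of_mem_vectorSpan h (v := -1)
              (htop ▸ trivial)
            have := hinf.1 h1
            simp at this
            linarith
          have hlt' : sInf I < y := lt_of_le_of_ne (hinf.1 hy) fun h => hnot (h ▸ hy)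
          filter_upwards [hpos, hlt (sub_pos.2 hlt')] with ε h0 h1
          obtain ⟨z, hz, -, hz2⟩ := hinf.exists_between (show sInf I < sInf I + ε by linarith)
          have : sInf I + ε ∈ I := hoc.out hz hy ⟨hz2.le, by linarith⟩
          simp [hnot, this]
        · rcases lt_or_gt_of_ne h with h | h
          · filter_upwards [hlt (sub_pos.2 h)] with ε hε
            have h1 : x ∉ I := fun hx => by linarith [hinf.1 hx]
            have h2 : x + ε ∉ I := fun hx => by linarith [hinf.1 hx]
            simp [h1, h2]
          · obtain ⟨z, hz, -, hz2⟩ := hinf.exists_between h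
            exact hmono x ⟨z, hz, hz2.le⟩
      · filter_upwards [eventually_lt_atBot (sInf I)] with M hM
        have : M ∉ I := fun h => by linarith [hinf.1 h]
        simp [this, hdim]
    · rw [not_bddBelow_iff] at hb
      refine ⟨0, 0, fun x => ?_, ?_⟩
      · obtain ⟨z, hz, hzx⟩ := hb x
        simpa using hmono x ⟨z, hz, hzx.le⟩
      · filter_upwards [eventually_le_atBot y] with M hM
        obtain ⟨z, hz, hzM⟩ := hb M
        have : M ∈ I := hoc.out hz hy ⟨hzM.le, hM⟩
        simp [this, hdim]

/-- By `exists_jump`, `(-1) ^ dim I` is the total jump of the indicator minus its value near `-∞`.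
Both terms are linear in the indicator, so they vanish on a relation. As the family is finite, one
`ε` and one `M` serve all its members. -/
theorem sum_mul_neg_one_pow_finrank_eq_zero_of_real {ι : Type*} (s : Finset ι) (I : ι → Set ℝ)
    (hI : ∀ i ∈ s, IsRelOpenConvex (I i)) (hne : ∀ i ∈ s, (I i).Nonempty) (c : ι → ℤ)
    (h : ∀ x, ∑ i ∈ s, c i * indicator (I i) 1 x = 0) :
    ∑ i ∈ s, c i * (-1) ^ Module.finrank ℝ (vectorSpan ℝ (I i)) = 0 := by
  classical
  have hex : ∀ i, ∃ (p : ℝ) (u : ℤ), i ∈ s → (∀ x, ∀ᶠ ε in 𝓝[>] (0 : ℝ),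
      indicator (I i) (1 : ℝ → ℤ) x - indicator (I i) 1 (x + ε) = if x = p then u else 0) ∧
      (∀ᶠ M in atBot, indicator (I i) (1 : ℝ → ℤ) M =
        u - (-1) ^ Module.finrank ℝ (vectorSpan ℝ (I i))) := by
    intro i
    by_cases hi : i ∈ s
    · obtain ⟨p, u, hpu⟩ := (hI i hi).exists_jump (hne i hi)
      exact ⟨p, u, fun _ => hpu⟩
    · exact ⟨0, 0, fun h => absurd h hi⟩
  choose p u hpu using hex
  have h1 : ∀ᶠ ε in 𝓝[>] (0 : ℝ), ∀ i ∈ s, ∀ x ∈ s.image p,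
      indicator (I i) (1 : ℝ → ℤ) x - indicator (I i) 1 (x + ε) = if x = p i then u i else 0 := by
    rw [Filter.eventually_all_finset]
    intro i hi
    rw [Filter.eventually_all_finset]
    exact fun x _ => (hpu i hi).1 x
  have h2 : ∀ᶠ M in atBot, ∀ i ∈ s, indicator (I i) (1 : ℝ → ℤ) M =
      u i - (-1) ^ Module.finrank ℝ (vectorSpan ℝ (I i)) := by
    rw [Filter.eventually_all_finset]
    exact fun i hi => (hpu i hi).2
  obtain ⟨ε, hε⟩ := h1.exists
  obtain ⟨M, hM⟩ := h2.exists
  have h3 : ∑ i ∈ s, c i * u i = 0 := by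
    calc ∑ i ∈ s, c i * u i
        = ∑ i ∈ s, c i * ∑ x ∈ s.image p,
            (indicator (I i) (1 : ℝ → ℤ) x - indicator (I i) 1 (x + ε)) := by
          refine Finset.sum_congr rfl fun i hi => ?_
          rw [Finset.sum_congr rfl (hε i hi), Finset.sum_ite_eq',
            if_pos (Finset.mem_image_of_mem p hi)]
      _ = ∑ x ∈ s.image p, (∑ i ∈ s, c i * indicator (I i) (1 : ℝ → ℤ) x -
            ∑ i ∈ s, c i * indicator (I i) (1 : ℝ → ℤ) (x + ε)) := by
          simp_rw [Finset.mul_sum, ← Finset.sum_sub_distrib, mul_sub]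
          rw [Finset.sum_comm]
      _ = 0 := by simp only [h, sub_zero, Finset.sum_const_zero]
  have h4 := h M
  rw [Finset.sum_congr rfl fun i hi => by rw [hM i hi, mul_sub], Finset.sum_sub_distrib, h3] at h4
  linarith

end Line

/-! ### The Euler relation in finite dimension and the resulting valuation -/

/-- The Euler relation: a linear relation between the indicator functions of relatively open convex
sets remains true when the indicator function of `U` is replaced by `(-1) ^ dim U`. -/
theorem sum_mul_neg_one_pow_finrank_eq_zero {E ι : Type*} [AddCommGroup E] [Module ℝ E]
    [FiniteDimensional ℝ E] (s : Finset ι) (U : ι → Set E)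
    (hU : ∀ i ∈ s, IsRelOpenConvex (U i)) (hne : ∀ i ∈ s, (U i).Nonempty) (c : ι → ℤ)
    (h : ∀ x, ∑ i ∈ s, c i * Set.indicator (U i) 1 x = 0) :
    ∑ i ∈ s, c i * (-1) ^ Module.finrank ℝ (vectorSpan ℝ (U i)) = 0 := by
  classical
  -- The sets are allowed to lie in a translate of `W`, because fibres of `l` lie in translates of
  -- `W ⊓ LinearMap.ker l`.
  suffices H : ∀ (n : ℕ) (W : Submodule ℝ E) (x₀ : E), Module.finrank ℝ W = n →
      ∀ (s : Finset ι) (U : ι → Set E), (∀ i ∈ s, IsRelOpenConvex (U i)) →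
      (∀ i ∈ s, (U i).Nonempty) → (∀ i ∈ s, ∀ x ∈ U i, x - x₀ ∈ W) → ∀ c : ι → ℤ,
      (∀ x, ∑ i ∈ s, c i * Set.indicator (U i) 1 x = 0) →
      ∑ i ∈ s, c i * (-1) ^ Module.finrank ℝ (vectorSpan ℝ (U i)) = 0 from
    H _ ⊤ 0 rfl s U hU hne (fun _ _ _ _ => trivial) c h
  clear! s U c
  intro n
  induction n with
  | zero =>
    intro W x₀ hW s U hU hne hs c h
    rw [Submodule.finrank_eq_zero] at hW
    subst hW
    rw [← h x₀]
    refine Finset.sum_congr rfl fun i hi => ?_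
    have : U i = {x₀} := Set.eq_singleton_iff_nonempty_unique_mem.2
      ⟨hne i hi, fun x hx => sub_eq_zero.1 ((Submodule.mem_bot ℝ).1 (hs i hi x hx))⟩
    rw [this, vectorSpan_singleton, finrank_bot]
    simp
  | succ n ih =>
    intro W x₀ hW s U hU hne hs c h
    obtain ⟨w, hw, hw0⟩ : ∃ w ∈ W, w ≠ 0 := by
      rw [← Submodule.ne_bot_iff]
      rintro rfl
      simp at hW
    obtain ⟨l, hl⟩ : ∃ l : E →ₗ[ℝ] ℝ, l w ≠ 0 := by
      by_contra! hl
      exact hw0 ((Module.forall_dual_apply_eq_zero_iff ℝ w).1 hl)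
    have hW' : Module.finrank ℝ ↥(W ⊓ LinearMap.ker l) = n := by
      have h1 := l.finrank_map_add_finrank_inf_ker W
      have h2 : W.map l = ⊤ := by
        rw [eq_top_iff]
        intro v _
        exact ⟨(v / l w) • w, W.smul_mem _ hw, by simp [div_mul_cancel₀ _ hl]⟩
      rw [h2, finrank_top, Module.finrank_self] at h1
      omega
    -- The relation on the fibre over `a`, with the fibre dimension rewritten, modulo 2, as `dim (l
    -- '' U) + dim U`. As `a` varies it becomes a relation between the images on the line, where the
    -- factor from `l '' U` then cancels.
    have hslice : ∀ a : ℝ, ∑ i ∈ s, c i * (-1) ^ (Module.finrank ℝ (vectorSpan ℝ (l '' U i)) +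
        Module.finrank ℝ (vectorSpan ℝ (U i))) * Set.indicator (l '' U i) 1 a = 0 := by
      intro a
      have hsum : ∑ i ∈ s with a ∈ l '' U i,
          c i * (-1) ^ Module.finrank ℝ (vectorSpan ℝ (U i ∩ l ⁻¹' {a})) = 0 := by
        rcases (s.filter fun i => a ∈ l '' U i).eq_empty_or_nonempty with he | ⟨j, hj⟩
        · rw [he, Finset.sum_empty]
        obtain ⟨hj, x₁, hx₁, hx₁a⟩ := Finset.mem_filter.1 hj
        refine ih (W ⊓ LinearMap.ker l) x₁ hW' _ (fun i => U i ∩ l ⁻¹' {a})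
          (fun i hi => (hU i (Finset.mem_filter.1 hi).1).inter_fiber l a) ?_ ?_ c ?_
        · intro i hi
          obtain ⟨-, x, hx, hxa⟩ := Finset.mem_filter.1 hi
          exact ⟨x, hx, hxa⟩
        · rintro i hi x ⟨hx, hxa⟩
          have hxa : l x = a := hxa
          refine ⟨?_, by simp [hxa, hx₁a]⟩
          have := W.sub_mem (hs i (Finset.mem_filter.1 hi).1 x hx) (hs j hj x₁ hx₁)
          simpa using this
        · intro x
          by_cases hx : l x = a
          · rw [Finset.sum_filter_of_ne, ← h x]
            · refine Finset.sum_congr rfl fun i _ => ?_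
              simp [Set.indicator_apply, hx]
            · intro i _ hi
              have := right_ne_zero_of_mul hi
              rw [Set.indicator_apply_ne_zero] at this
              exact ⟨x, this.1.1, hx⟩
          · refine Finset.sum_eq_zero fun i _ => ?_
            simp [hx]
      rw [← hsum, Finset.sum_filter]
      refine Finset.sum_congr rfl fun i hi => ?_
      split_ifs with ha
      · obtain ⟨x, hx, hxa⟩ := ha
        rw [← (hU i hi).finrank_inter_fiber l (a := a) ⟨x, hx, hxa⟩, ← add_assoc, pow_add,
          Even.neg_one_pow ⟨_, rfl⟩, Set.indicator_of_mem (Set.mem_image l (U i) a |>.2 ⟨x, hx, hxa⟩)]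
        simp
      · simp [Set.indicator_of_notMem ha]
    have := sum_mul_neg_one_pow_finrank_eq_zero_of_real s (fun i => l '' U i)
      (fun i hi => (hU i hi).image l) (fun i hi => (hne i hi).image l) _ hslice
    rw [← this]
    refine Finset.sum_congr rfl fun i _ => ?_
    rw [mul_assoc, ← pow_add, add_right_comm, pow_add, Even.neg_one_pow ⟨_, rfl⟩, one_mul]

/-- The graph of the Euler characteristic, the additive functional on the integral combinations of
indicator functions of relatively open convex sets `U` that takes the value `(-1) ^ dim U` on
the indicator function of `U`. -/
def eulerGraph (E : Type*) [AddCommGroup E] [Module ℝ E] : Submodule ℤ ((E → ℤ) × ℤ) :=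
  Submodule.span ℤ (Set.range fun U : {U : Set E // IsRelOpenConvex U ∧ U.Nonempty} =>
    (Set.indicator U.1 1, (-1) ^ Module.finrank ℝ (vectorSpan ℝ U.1)))

theorem indicator_mem_eulerGraph {E : Type*} [AddCommGroup E] [Module ℝ E] {U : Set E}
    (hU : IsRelOpenConvex U) (hne : U.Nonempty) :
    ((Set.indicator U 1, (-1) ^ Module.finrank ℝ (vectorSpan ℝ U)) : (E → ℤ) × ℤ) ∈
      eulerGraph E :=
  Submodule.subset_span ⟨⟨U, hU, hne⟩, rfl⟩

/-- The difference `(0, m - n)` lies in the span, so it comes from a linear relation between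
indicators. -/
theorem eq_of_mem_eulerGraph {E : Type*} [AddCommGroup E] [Module ℝ E] [FiniteDimensional ℝ E]
    {f : E → ℤ} {m n : ℤ} (hm : (f, m) ∈ eulerGraph E) (hn : (f, n) ∈ eulerGraph E) : m = n := by
  have h := Submodule.sub_mem _ hm hn
  rw [eulerGraph, Finsupp.mem_span_range_iff_exists_finsupp] at h
  obtain ⟨c, hc⟩ := h
  rw [Finsupp.sum, Prod.ext_iff] at hc
  obtain ⟨h1, h2⟩ := hc
  simp only [Prod.fst_sum, Prod.snd_sum, Prod.smul_fst, Prod.smul_snd, Prod.fst_sub, Prod.snd_sub,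
    smul_eq_mul, sub_self] at h1 h2
  have := sum_mul_neg_one_pow_finrank_eq_zero c.support (fun U => U.1) (fun U _ => U.2.1)
    (fun U _ => U.2.2) c (fun x => by simpa using congrFun h1 x)
  linarith

/-! ### Relative interiors of convex sets -/

section RelCore

variable {E : Type*} [AddCommGroup E] [Module ℝ E] {σ : Set E}

/-- The algebraic relative interior of a convex set: the points beyond which every segment of the
set that ends there can be prolonged. -/
def relCore (σ : Set E) : Set E :=
  {x ∈ σ | ∀ y ∈ σ, ∃ ε : ℝ, 0 < ε ∧ x + ε • (x - y) ∈ σ}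

theorem relCore_subset : relCore σ ⊆ σ := fun _ h => h.1

theorem Convex.add_smul_sub_mem_relCore (hσ : Convex ℝ σ) {x z : E} (hx : x ∈ relCore σ)
    (hz : z ∈ σ) {t : ℝ} (ht : 0 ≤ t) (ht1 : t < 1) : x + t • (z - x) ∈ relCore σ := by
  refine ⟨hσ.add_smul_sub_mem hx.1 hz ⟨ht, ht1.le⟩, fun u hu => ?_⟩
  obtain ⟨ε, hε, h⟩ := hx.2 u hu
  have hpos : 0 < t * ε + 1 := by positivity
  have h1t : 0 < 1 - t := by linarith
  -- The prolonged point is sought on the segment from `z` to `x + ε • (x - u)`; comparing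
  -- coefficients forces this value.
  refine ⟨(1 - t) * ε / (t * ε + 1), by positivity, ?_⟩
  have := hσ hz h (a := t * (1 + ε) / (t * ε + 1)) (b := (1 - t) / (t * ε + 1)) (by positivity)
    (by positivity) (by field_simp; ring)
  convert this using 1
  match_scalars <;> field_simp <;> ring

theorem Convex.isRelOpenConvex_relCore (hσ : Convex ℝ σ) : IsRelOpenConvex (relCore σ) := by
  refine ⟨?_, ?_⟩
  · intro x hx y hy a b ha hb hab
    rcases hb.eq_or_lt with rfl | hb'
    · obtain rfl : a = 1 := by linarith
      simpa using hx
    rcases ha.eq_or_lt with rfl | ha'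
    · obtain rfl : b = 1 := by linarith
      simpa using hy
    · convert hσ.add_smul_sub_mem_relCore hx hy.1 hb (by linarith) using 1
      obtain rfl : a = 1 - b := by linarith
      module
  · intro x hx y hy
    obtain ⟨ε, hε, h⟩ := hx.2 y hy.1
    refine ⟨ε / 2, by positivity, ?_⟩
    convert hσ.add_smul_sub_mem_relCore hx h (t := 1 / 2) (by norm_num) (by norm_num) using 1
    module

theorem Convex.vectorSpan_relCore (hσ : Convex ℝ σ) (hne : (relCore σ).Nonempty) :
    vectorSpan ℝ (relCore σ) = vectorSpan ℝ σ := by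
  refine le_antisymm (vectorSpan_mono ℝ relCore_subset) ?_
  obtain ⟨x, hx⟩ := hne
  rw [vectorSpan_eq_span_vsub_set_right ℝ hx.1, Submodule.span_le]
  rintro _ ⟨y, hy, rfl⟩
  have h := vsub_mem_vectorSpan ℝ
    (hσ.add_smul_sub_mem_relCore hx hy (t := 1 / 2) (by norm_num) (by norm_num)) hx
  rw [vsub_eq_sub, add_sub_cancel_left] at h
  simpa [smul_smul] using Submodule.smul_mem _ 2 h

/-- A functional maximal at `x` cannot be smaller at `y`, or it would increase on prolonging the
segment from `y` beyond `x`. -/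
theorem IsExposed.eq_of_mem_relCore [TopologicalSpace E] {τ : Set E} (h : IsExposed ℝ σ τ) {x : E}
    (hx : x ∈ relCore σ) (hxτ : x ∈ τ) : τ = σ := by
  obtain ⟨l, rfl⟩ := h ⟨x, hxτ⟩
  refine Set.Subset.antisymm (fun _ h => h.1) fun y hy => ⟨hy, fun u hu => ?_⟩
  obtain ⟨ε, hε, h⟩ := hx.2 y hy
  have h1 := hxτ.2 _ h
  have h2 := hxτ.2 u hu
  simp only [map_add, map_smul, map_sub, smul_eq_mul] at h1
  have : 0 ≤ l y - l x := by
    by_contra! h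
    nlinarith
  linarith

end RelCore

/-! ### Polyhedra and tight inequalities -/

section Polyhedron

open Filter Topology

variable {d : ℕ}

/-- The scalar product with a fixed vector. -/
noncomputable def dotFunctional (a : Fin d → ℝ) : (Fin d → ℝ) →L[ℝ] ℝ :=
  LinearMap.toContinuousLinearMap (dotProductBilin ℝ ℝ a)

@[simp]
theorem dotFunctional_apply (a x : Fin d → ℝ) : dotFunctional a x = a ⬝ᵥ x := rfl

theorem IsPolyhedron.convex {P : Set (Fin d → ℝ)} (hP : IsPolyhedron P) : Convex ℝ P := by
  obtain ⟨H, rfl⟩ := hP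
  intro x hx y hy a b ha hb hab p hp
  have h1 := mul_le_mul_of_nonneg_left (hx p hp) ha
  have h2 := mul_le_mul_of_nonneg_left (hy p hp) hb
  simp only [dotProduct_add, dotProduct_smul, smul_eq_mul]
  have : a * p.2 + b * p.2 = p.2 := by rw [← add_mul, hab, one_mul]
  linarith

/-- A segment from `y` to `z` in a polyhedron can be prolonged beyond `z` if the inequalities that
are tight at `z` are tight at `y`. -/
theorem exists_add_smul_sub_mem_of_tight (H : Finset ((Fin d → ℝ) × ℝ)) {z y : Fin d → ℝ}
    (hz : ∀ p ∈ H, p.1 ⬝ᵥ z ≤ p.2) (h : ∀ p ∈ H, p.1 ⬝ᵥ z = p.2 → p.1 ⬝ᵥ y = p.2) :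
    ∃ ε : ℝ, 0 < ε ∧ ∀ p ∈ H, p.1 ⬝ᵥ (z + ε • (z - y)) ≤ p.2 := by
  have hev : ∀ᶠ ε in 𝓝[>] (0 : ℝ), ∀ p ∈ H, p.1 ⬝ᵥ (z + ε • (z - y)) ≤ p.2 := by
    rw [Filter.eventually_all_finset]
    intro p hp
    simp only [dotProduct_add, dotProduct_smul, dotProduct_sub, smul_eq_mul]
    rcases (hz p hp).eq_or_lt with he | hlt
    · simp [he, h p hp he]
    · have ht : Tendsto (fun ε : ℝ => p.1 ⬝ᵥ z + ε * (p.1 ⬝ᵥ z - p.1 ⬝ᵥ y)) (𝓝 0)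
          (𝓝 (p.1 ⬝ᵥ z + 0 * (p.1 ⬝ᵥ z - p.1 ⬝ᵥ y))) :=
        Continuous.tendsto (by fun_prop) 0
      rw [zero_mul, add_zero] at ht
      exact nhdsWithin_le_nhds ((ht.eventually_lt_const hlt).mono fun _ h => h.le)
  obtain ⟨ε, h1, h2⟩ := (hev.and eventually_mem_nhdsWithin).exists
  exact ⟨ε, h2, h1⟩

/-- A nonempty convex subset of a polyhedron has a point at which as few inequalities are tight as
possible. -/
theorem Convex.exists_tight_imp_tight (H : Finset ((Fin d → ℝ) × ℝ)) {C : Set (Fin d → ℝ)}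
    (hC : Convex ℝ C) (hne : C.Nonempty) (hCH : ∀ x ∈ C, ∀ p ∈ H, p.1 ⬝ᵥ x ≤ p.2) :
    ∃ z ∈ C, ∀ y ∈ C, ∀ p ∈ H, p.1 ⬝ᵥ z = p.2 → p.1 ⬝ᵥ y = p.2 := by
  classical
  obtain ⟨z, hz, hmin⟩ : ∃ z ∈ C, ∀ y ∈ C,
      (H.filter fun p => p.1 ⬝ᵥ z = p.2).card ≤ (H.filter fun p => p.1 ⬝ᵥ y = p.2).card := by
    let f : (Fin d → ℝ) → ℕ := fun z => (H.filter fun p => p.1 ⬝ᵥ z = p.2).card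
    exact ⟨Function.argminOn f C hne, Function.argminOn_mem f C hne,
      fun y hy => Function.argminOn_le f C hy⟩
  refine ⟨z, hz, fun y hy => ?_⟩
  -- An inequality tight at the midpoint is tight at both ends, so by minimality `w` and `z` have
  -- the same tight inequalities.
  set w := midpoint ℝ z y with hw
  have hwC : w ∈ C := hC.midpoint_mem hz hy
  have htight : ∀ p ∈ H, p.1 ⬝ᵥ w = p.2 → p.1 ⬝ᵥ z = p.2 ∧ p.1 ⬝ᵥ y = p.2 := by
    intro p hp h
    have h1 := hCH z hz p hp
    have h2 := hCH y hy p hp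
    rw [hw, midpoint_eq_smul_add, invOf_eq_inv, dotProduct_smul, dotProduct_add, smul_eq_mul] at h
    constructor <;> linarith
  have heq := Finset.eq_of_subset_of_card_le
    (fun p hp => Finset.mem_filter.2 ⟨(Finset.mem_filter.1 hp).1,
      (htight p (Finset.mem_filter.1 hp).1 (Finset.mem_filter.1 hp).2).1⟩) (hmin w hwC)
  intro p hp hpz
  have : p ∈ H.filter fun p => p.1 ⬝ᵥ w = p.2 := by
    rw [heq]; exact Finset.mem_filter.2 ⟨hp, hpz⟩
  exact (htight p hp (Finset.mem_filter.1 this).2).2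

theorem IsPolyhedron.relCore_nonempty {P : Set (Fin d → ℝ)} (hP : IsPolyhedron P)
    (hne : P.Nonempty) : (relCore P).Nonempty := by
  have hc := hP.convex
  obtain ⟨H, rfl⟩ := hP
  obtain ⟨z, hz, h⟩ := hc.exists_tight_imp_tight H hne fun _ hx => hx
  exact ⟨z, hz, fun y hy => exists_add_smul_sub_mem_of_tight H hz (h y hy)⟩

/-- A point of a polyhedron outside the relative interior lies on a proper face. -/
theorem IsPolyhedron.exists_isExposed_of_notMem_relCore {P : Set (Fin d → ℝ)} (hP : IsPolyhedron P)
    {x : Fin d → ℝ} (hx : x ∈ P) (hx' : x ∉ relCore P) :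
    ∃ τ, IsExposed ℝ P τ ∧ x ∈ τ ∧ ¬ P ⊆ τ := by
  obtain ⟨H, rfl⟩ := hP
  obtain ⟨y, hy, hxy⟩ : ∃ y, (∀ p ∈ H, p.1 ⬝ᵥ y ≤ p.2) ∧
      ¬ ∃ ε : ℝ, 0 < ε ∧ ∀ p ∈ H, p.1 ⬝ᵥ (x + ε • (x - y)) ≤ p.2 := by
    by_contra! h
    exact hx' ⟨hx, h⟩
  have : ∃ p ∈ H, p.1 ⬝ᵥ x = p.2 ∧ p.1 ⬝ᵥ y ≠ p.2 := by
    by_contra! h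
    exact hxy (exists_add_smul_sub_mem_of_tight H hx h)
  obtain ⟨p, hp, hpx, hpy⟩ := this
  refine ⟨(dotFunctional p.1).toExposed _, ContinuousLinearMap.toExposed.isExposed, ⟨hx, fun u hu => ?_⟩, fun h => hpy ?_⟩
  · simpa [hpx] using hu p hp
  · have := (h hy).2 x hx
    simp only [dotFunctional_apply, hpx] at this
    exact le_antisymm (hy p hp) this

end Polyhedron

/-! ### The Euler characteristic of a complex depends only on its support -/

namespace PolyhedralComplex

variable {d : ℕ} (K : PolyhedralComplex d)

theorem eq_of_mem_relCore {σ τ : Set (Fin d → ℝ)} (hσ : σ ∈ K.cells) (hτ : τ ∈ K.cells)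
    {x : Fin d → ℝ} (hxσ : x ∈ relCore σ) (hxτ : x ∈ relCore τ) : σ = τ := by
  obtain ⟨h1, h2⟩ := K.inter_isFace σ hσ τ hτ
  exact (h1.eq_of_mem_relCore hxσ ⟨hxσ.1, hxτ.1⟩).symm.trans
    (h2.eq_of_mem_relCore hxτ ⟨hxσ.1, hxτ.1⟩)

/-- In a minimal cell containing `x`, the point is relatively interior; otherwise a proper face
through `x` would be a smaller cell. -/
theorem exists_mem_relCore {x : Fin d → ℝ} (hx : x ∈ K.support) :
    ∃ σ ∈ K.cells, x ∈ relCore σ := by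
  classical
  simp only [support, Set.mem_iUnion, exists_prop] at hx
  obtain ⟨σ₀, hσ₀, hx₀⟩ := hx
  obtain ⟨σ, hσ⟩ := (K.cells.filter fun σ => x ∈ σ).exists_minimal
    ⟨σ₀, Finset.mem_filter.2 ⟨hσ₀, hx₀⟩⟩
  obtain ⟨hσK, hxσ⟩ := Finset.mem_filter.1 hσ.prop
  refine ⟨σ, hσK, ?_⟩
  by_contra h
  obtain ⟨τ, hτ, hxτ, hne⟩ :=
    (K.cell_isPolyhedron σ hσK).exists_isExposed_of_notMem_relCore hxσ h
  exact hne (hσ.le_of_le (Finset.mem_filter.2 ⟨K.face_mem σ hσK τ ⟨x, hxτ⟩ hτ, hxτ⟩) hτ.subset)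

theorem mem_eulerGraph :
    ((K.support.indicator 1, K.eulerChar) : ((Fin d → ℝ) → ℤ) × ℤ) ∈ eulerGraph (Fin d → ℝ) := by
  classical
  have h : ((K.support.indicator 1, K.eulerChar) : ((Fin d → ℝ) → ℤ) × ℤ) =
      ∑ σ ∈ K.cells, ((relCore σ).indicator 1,
        (-1) ^ Module.finrank ℝ (vectorSpan ℝ (relCore σ))) := by
    refine Prod.ext ?_ ?_
    · rw [Prod.fst_sum]
      funext x
      rw [Finset.sum_apply]
      by_cases hx : x ∈ K.support
      · obtain ⟨σ, hσ, hxσ⟩ := K.exists_mem_relCore hx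
        rw [Finset.sum_eq_single_of_mem σ hσ]
        · simp [hx, hxσ]
        · intro τ hτ hne
          exact Set.indicator_of_notMem (fun h => hne (K.eq_of_mem_relCore hτ hσ h hxσ)) _
      · refine (Set.indicator_of_notMem hx _).trans (Eq.symm ?_)
        refine Finset.sum_eq_zero fun σ hσ => Set.indicator_of_notMem (fun h => hx ?_) _
        exact Set.mem_biUnion (show σ ∈ (K.cells : Set _) from hσ) h.1
    · rw [Prod.snd_sum]
      refine Finset.sum_congr rfl fun σ hσ => ?_
      have hP := K.cell_isPolyhedron σ hσ
      rw [hP.convex.vectorSpan_relCore (hP.relCore_nonempty (K.cell_nonempty σ hσ))]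
  rw [h]
  refine Submodule.sum_mem _ fun σ hσ => ?_
  have hP := K.cell_isPolyhedron σ hσ
  exact indicator_mem_eulerGraph hP.convex.isRelOpenConvex_relCore
    (hP.relCore_nonempty (K.cell_nonempty σ hσ))

end PolyhedralComplex

/-! ### Tropical signomials as functions -/

namespace TropicalSignomial

variable {d : ℕ} (g h : TropicalSignomial d)

theorem termEval_add (s t : (Fin d → ℝ) × ℝ) (x : Fin d → ℝ) :
    termEval (s + t) x = termEval s x + termEval t x := by
  simp only [termEval, Prod.fst_add, Prod.snd_add, add_dotProduct]
  ring

theorem continuous_termEval (t : (Fin d → ℝ) × ℝ) : Continuous (termEval t) :=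
  (dotFunctional t.1).continuous.add continuous_const

theorem termEval_combo (t : (Fin d → ℝ) × ℝ) (x y : Fin d → ℝ) {a b : ℝ} (hab : a + b = 1) :
    termEval t (a • x + b • y) = a * termEval t x + b * termEval t y := by
  obtain rfl : a = 1 - b := by linarith
  simp only [termEval, dotProduct_add, dotProduct_smul, smul_eq_mul]
  ring

variable {g} in
theorem termEval_le_eval {t : (Fin d → ℝ) × ℝ} (ht : t ∈ g.terms) (x : Fin d → ℝ) :
    termEval t x ≤ g.eval x :=
  Finset.le_sup' (fun t => termEval t x) ht

theorem exists_termEval_eq_eval (x : Fin d → ℝ) : ∃ t ∈ g.terms, termEval t x = g.eval x := by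
  obtain ⟨t, ht, h⟩ := Finset.exists_mem_eq_sup' g.nonempty fun t => termEval t x
  exact ⟨t, ht, h.symm⟩

theorem mul_terms : (g * h).terms = g.terms + h.terms := rfl

theorem eval_mul (x : Fin d → ℝ) : (g * h).eval x = g.eval x + h.eval x := by
  apply le_antisymm
  · obtain ⟨t, ht, he⟩ := (g * h).exists_termEval_eq_eval x
    obtain ⟨u, hu, v, hv, rfl⟩ := Finset.mem_add.1 (g.mul_terms h ▸ ht)
    rw [← he, termEval_add]
    exact add_le_add (termEval_le_eval hu x) (termEval_le_eval hv x)
  · obtain ⟨u, hu, hue⟩ := g.exists_termEval_eq_eval x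
    obtain ⟨v, hv, hve⟩ := h.exists_termEval_eq_eval x
    rw [← hue, ← hve, ← termEval_add]
    exact termEval_le_eval (g.mul_terms h ▸ Finset.add_mem_add hu hv) x

/-! ### Regions -/

/-- The open region on which `t` is larger than all other monomials of `g`. -/
def region (t : (Fin d → ℝ) × ℝ) : Set (Fin d → ℝ) :=
  {x | ∀ s ∈ g.terms, s ≠ t → termEval s x < termEval t x}

variable {g} in
theorem eval_eq_of_mem_region {t : (Fin d → ℝ) × ℝ} (ht : t ∈ g.terms) {x : Fin d → ℝ}
    (hx : x ∈ g.region t) : g.eval x = termEval t x := by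
  refine le_antisymm ?_ (termEval_le_eval ht x)
  obtain ⟨s, hs, he⟩ := g.exists_termEval_eq_eval x
  rcases eq_or_ne s t with rfl | hne
  · exact he.ge
  · exact he ▸ (hx s hs hne).le

variable {g} in
theorem eq_of_mem_region {s t : (Fin d → ℝ) × ℝ} (hs : s ∈ g.terms) (ht : t ∈ g.terms)
    {x : Fin d → ℝ} (hxs : x ∈ g.region s) (hxt : x ∈ g.region t) : s = t := by
  by_contra hne
  exact lt_asymm (hxs t ht (Ne.symm hne)) (hxt s hs hne)

theorem notMem_hypersurface_iff {x : Fin d → ℝ} :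
    x ∉ g.hypersurface ↔ ∃ t ∈ g.terms, x ∈ g.region t := by
  constructor
  · intro hx
    obtain ⟨t, ht, hte⟩ := g.exists_termEval_eq_eval x
    refine ⟨t, ht, fun s hs hne => lt_of_le_of_ne (hte ▸ termEval_le_eval hs x) fun he => hx ?_⟩
    exact ⟨s, hs, t, ht, hne, he.trans hte, hte⟩
  · rintro ⟨t, ht, hx⟩ ⟨u, hu, v, hv, hne, hue, hve⟩
    rw [eval_eq_of_mem_region ht hx] at hue hve
    have key : ∀ w ∈ g.terms, termEval w x = termEval t x → w = t := by
      intro w hw hwe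
      by_contra h
      exact (hx w hw h).ne hwe
    exact hne ((key u hu hue).trans (key v hv hve).symm)

theorem isOpen_region (t : (Fin d → ℝ) × ℝ) : IsOpen (g.region t) := by
  have : g.region t = ⋂ s ∈ g.terms, {x | s ≠ t → termEval s x < termEval t x} := by
    ext; simp [region]
  rw [this]
  refine isOpen_biInter_finset fun s _ => ?_
  by_cases hst : s = t
  · simp [hst]
  · simpa [hst] using isOpen_lt (continuous_termEval s) (continuous_termEval t)

theorem convex_region (t : (Fin d → ℝ) × ℝ) : Convex ℝ (g.region t) := by
  intro x hx y hy a b ha hb hab s hs hne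
  rw [termEval_combo s x y hab, termEval_combo t x y hab]
  have h1 := hx s hs hne
  have h2 := hy s hs hne
  rcases ha.eq_or_lt with rfl | ha'
  · obtain rfl : b = 1 := by linarith
    simpa using h2
  · exact add_lt_add_of_lt_of_le (mul_lt_mul_of_pos_left h1 ha')
      (mul_le_mul_of_nonneg_left h2.le hb)

theorem not_isRedundant_iff {t : (Fin d → ℝ) × ℝ} (ht : t ∈ g.terms) :
    ¬ g.IsRedundant t ↔ (g.region t).Nonempty := by
  constructor
  · intro hr
    by_cases hne : (g.terms.erase t).Nonempty
    · have : ∃ x, eval ⟨g.terms.erase t, hne⟩ x ≠ g.eval x := by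
        by_contra! h
        exact hr ⟨hne, h⟩
      obtain ⟨x, hx⟩ := this
      obtain ⟨u, hu, hue⟩ := exists_termEval_eq_eval ⟨g.terms.erase t, hne⟩ x
      have hlt : eval ⟨g.terms.erase t, hne⟩ x < g.eval x :=
        lt_of_le_of_ne (hue ▸ termEval_le_eval (Finset.mem_of_mem_erase hu) x) hx
      obtain ⟨v, hv, hve⟩ := g.exists_termEval_eq_eval x
      have hle : ∀ s ∈ g.terms, s ≠ t → termEval s x < g.eval x := fun s hs hst =>
        (termEval_le_eval (g := ⟨g.terms.erase t, hne⟩) (Finset.mem_erase.2 ⟨hst, hs⟩) x).trans_lt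
          hlt
      obtain rfl : v = t := by
        by_contra h
        exact (hle v hv h).ne hve
      exact ⟨x, fun s hs hst => hve ▸ hle s hs hst⟩
    -- A sole monomial has all of space as its region.
    · refine ⟨0, fun s hs hst => absurd ⟨s, Finset.mem_erase.2 ⟨hst, hs⟩⟩ hne⟩
  · rintro ⟨x, hx⟩ ⟨hne, he⟩
    obtain ⟨u, hu, hue⟩ := exists_termEval_eq_eval ⟨g.terms.erase t, hne⟩ x
    rw [he x, eval_eq_of_mem_region ht hx] at hue
    exact (hx u (Finset.mem_of_mem_erase hu) (Finset.ne_of_mem_erase hu)).ne hue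

/-- The monomials of the reduced form. -/
def essentialTerms : Set ((Fin d → ℝ) × ℝ) := {t | t ∈ g.terms ∧ (g.region t).Nonempty}

theorem finite_essentialTerms : g.essentialTerms.Finite :=
  g.terms.finite_toSet.subset fun _ h => h.1

theorem mlen_eq_card : g.mlen = g.finite_essentialTerms.toFinset.card := by
  classical
  rw [mlen]
  congr 1
  ext t
  simp only [Finset.mem_filter, Set.Finite.mem_toFinset, essentialTerms, Set.mem_ofPred_eq]
  exact and_congr_right fun ht => g.not_isRedundant_iff ht

/-- Sending a point to its dominant monomial is locally constant, and its fibres, the regions, are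
convex and hence connected. -/
theorem card_connectedComponents :
    Nat.card (ConnectedComponents ↥(g.hypersurface)ᶜ) = g.mlen := by
  classical
  have hex : ∀ x : ↥(g.hypersurface)ᶜ, ∃ t : g.essentialTerms, x.1 ∈ g.region t.1 := by
    intro x
    obtain ⟨t, ht, hx⟩ := g.notMem_hypersurface_iff.1 x.2
    exact ⟨⟨t, ht, x.1, hx⟩, hx⟩
  choose q hq using hex
  have hq' : ∀ (x : ↥(g.hypersurface)ᶜ) (t : g.essentialTerms), q x = t ↔ x.1 ∈ g.region t.1 :=
    fun x t => ⟨fun h => h ▸ hq x, fun h => Subtype.ext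
      (eq_of_mem_region (q x).2.1 t.2.1 (hq x) h)⟩
  let : TopologicalSpace g.essentialTerms := ⊥
  have : DiscreteTopology g.essentialTerms := ⟨rfl⟩
  have hcont : Continuous q := by
    rw [continuous_discrete_rng]
    intro t
    have : q ⁻¹' {t} = Subtype.val ⁻¹' g.region t.1 := by
      ext x
      exact hq' x t
    rw [this]
    exact (g.isOpen_region t.1).preimage continuous_subtype_val
  have hbij : Function.Bijective hcont.connectedComponentsLift := by
    constructor
    · intro x y
      obtain ⟨x, rfl⟩ := ConnectedComponents.surjective_coe x
      obtain ⟨y, rfl⟩ := ConnectedComponents.surjective_coe y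
      rw [hcont.connectedComponentsLift_apply_coe, hcont.connectedComponentsLift_apply_coe]
      intro hxy
      rw [ConnectedComponents.coe_eq_coe']
      have hpre : IsPreconnected (Subtype.val ⁻¹' g.region (q y).1 : Set ↥(g.hypersurface)ᶜ) := by
        rw [Topology.IsInducing.subtypeVal.isPreconnected_image.symm]
        have hsub : g.region (q y).1 ⊆ (g.hypersurface)ᶜ := fun z hz =>
          g.notMem_hypersurface_iff.2 ⟨_, (q y).2.1, hz⟩
        rw [Subtype.image_preimage_coe, Set.inter_eq_right.2 hsub]
        exact (g.convex_region _).isPreconnected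
      exact hpre.subset_connectedComponent (hq y) ((hq' x (q y)).1 hxy)
    · intro t
      obtain ⟨x, hx⟩ := t.2.2
      refine ⟨((⟨x, g.notMem_hypersurface_iff.2 ⟨t.1, t.2.1, hx⟩⟩ : ↥(g.hypersurface)ᶜ) :
        ConnectedComponents ↥(g.hypersurface)ᶜ), ?_⟩
      rw [hcont.connectedComponentsLift_apply_coe, hq']
      exact hx
  rw [Nat.card_eq_of_bijective _ hbij, mlen_eq_card, Nat.card_coe_set_eq,
    Set.ncard_eq_toFinset_card _ g.finite_essentialTerms]

/-- The Euler characteristic of a tropical hypersurface. -/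
theorem hypersurface_mem_eulerGraph :
    ((g.hypersurface.indicator 1, (-1) ^ d * (1 - g.mlen)) : ((Fin d → ℝ) → ℤ) × ℤ) ∈
      eulerGraph (Fin d → ℝ) := by
  classical
  have hopen : ∀ U : Set (Fin d → ℝ), IsOpen U → Convex ℝ U → U.Nonempty →
      ((U.indicator 1, (-1) ^ d) : ((Fin d → ℝ) → ℤ) × ℤ) ∈ eulerGraph (Fin d → ℝ) := by
    intro U ho hc hne
    have hspan : vectorSpan ℝ U = ⊤ := by
      rw [← direction_affineSpan, ho.affineSpan_eq_top hne, AffineSubspace.direction_top]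
    have hrel : IsRelOpenConvex U := by
      refine ⟨hc, fun x hx y _ => ?_⟩
      have ht : Filter.Tendsto (fun ε : ℝ => x + ε • (x - y)) (nhds 0)
          (nhds (x + (0 : ℝ) • (x - y))) := Continuous.tendsto (by fun_prop) 0
      rw [zero_smul, add_zero] at ht
      have h1 : ∀ᶠ ε in nhdsWithin (0 : ℝ) (Set.Ioi 0), x + ε • (x - y) ∈ U :=
        nhdsWithin_le_nhds (ht (ho.mem_nhds hx))
      obtain ⟨ε, h, hε⟩ := (h1.and eventually_mem_nhdsWithin).exists
      exact ⟨ε, hε, h⟩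
    have := indicator_mem_eulerGraph hrel hne
    rwa [hspan, finrank_top, Module.finrank_fin_fun] at this
  -- The hypersurface is all of space minus the disjoint nonempty regions.
  have h : ((g.hypersurface.indicator 1, (-1) ^ d * (1 - g.mlen)) : ((Fin d → ℝ) → ℤ) × ℤ) =
      (Set.univ.indicator 1, (-1) ^ d) -
        ∑ t ∈ g.finite_essentialTerms.toFinset, ((g.region t).indicator 1, (-1) ^ d) := by
    refine Prod.ext ?_ ?_
    · rw [Prod.fst_sub, Prod.fst_sum]
      funext x
      rw [Pi.sub_apply, Finset.sum_apply]
      by_cases hx : x ∈ g.hypersurface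
      · rw [Finset.sum_eq_zero]
        · simp [hx]
        · intro t ht
          refine Set.indicator_of_notMem (fun h => ?_) _
          exact g.notMem_hypersurface_iff.2 ⟨t, (g.finite_essentialTerms.mem_toFinset.1 ht).1, h⟩ hx
      · obtain ⟨t, ht, hxt⟩ := g.notMem_hypersurface_iff.1 hx
        rw [Finset.sum_eq_single_of_mem t (g.finite_essentialTerms.mem_toFinset.2 ⟨ht, x, hxt⟩)]
        · simp [hx, hxt]
        · intro s hs hne
          exact Set.indicator_of_notMem (fun h => hne (eq_of_mem_region
            (g.finite_essentialTerms.mem_toFinset.1 hs).1 ht h hxt)) _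
    · rw [Prod.snd_sub, Prod.snd_sum, mlen_eq_card, Finset.sum_const, nsmul_eq_mul]
      ring
  rw [h]
  refine Submodule.sub_mem _ (hopen _ isOpen_univ convex_univ Set.univ_nonempty)
    (Submodule.sum_mem _ fun t ht => hopen _ (g.isOpen_region t) (g.convex_region t)
      (g.finite_essentialTerms.mem_toFinset.1 ht).2)

/-! ### Products -/

theorem hypersurface_one : (1 : TropicalSignomial d).hypersurface = ∅ := by
  refine Set.eq_empty_iff_forall_notMem.2 ?_
  rintro x ⟨s, hs, t, ht, hne, -⟩
  exact hne ((Finset.mem_zero.1 hs).trans (Finset.mem_zero.1 ht).symm)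

variable {g h} in
theorem termEval_add_eq_eval_mul_iff {s t : (Fin d → ℝ) × ℝ} (hs : s ∈ g.terms) (ht : t ∈ h.terms)
    {x : Fin d → ℝ} : termEval (s + t) x = (g * h).eval x ↔
      termEval s x = g.eval x ∧ termEval t x = h.eval x := by
  rw [eval_mul, termEval_add]
  exact add_eq_add_iff_eq_and_eq (termEval_le_eval hs x) (termEval_le_eval ht x)

theorem hypersurface_subset_mul : g.hypersurface ⊆ (g * h).hypersurface := by
  rintro x ⟨s, hs, t, ht, hne, hse, hte⟩
  obtain ⟨u, hu, hue⟩ := h.exists_termEval_eq_eval x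
  exact ⟨s + u, Finset.add_mem_add hs hu, t + u, Finset.add_mem_add ht hu, by simpa using hne,
    (termEval_add_eq_eval_mul_iff hs hu).2 ⟨hse, hue⟩,
    (termEval_add_eq_eval_mul_iff ht hu).2 ⟨hte, hue⟩⟩

theorem hypersurface_mul : (g * h).hypersurface = g.hypersurface ∪ h.hypersurface := by
  refine Set.Subset.antisymm ?_ (Set.union_subset (g.hypersurface_subset_mul h)
    (mul_comm g h ▸ h.hypersurface_subset_mul g))
  rintro x ⟨s, hs, t, ht, hne, hse, hte⟩
  obtain ⟨s₁, hs₁, s₂, hs₂, rfl⟩ := Finset.mem_add.1 hs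
  obtain ⟨t₁, ht₁, t₂, ht₂, rfl⟩ := Finset.mem_add.1 ht
  rw [termEval_add_eq_eval_mul_iff hs₁ hs₂] at hse
  rw [termEval_add_eq_eval_mul_iff ht₁ ht₂] at hte
  by_cases h1 : s₁ = t₁
  · refine Or.inr ⟨s₂, hs₂, t₂, ht₂, fun h2 => hne (by rw [h1, h2]), hse.2, hte.2⟩
  · exact Or.inl ⟨s₁, hs₁, t₁, ht₁, h1, hse.1, hte.1⟩

theorem hypersurface_prod {ι : Type*} (s : Finset ι) (g : ι → TropicalSignomial d) :
    (∏ i ∈ s, g i).hypersurface = ⋃ i ∈ s, (g i).hypersurface := by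
  classical
  induction s using Finset.induction_on with
  | empty => simp [hypersurface_one]
  | insert i s hi ih => rw [Finset.prod_insert hi, hypersurface_mul, ih, Finset.set_biUnion_insert]

/-! ### The polyhedral complex of domains of linearity -/

/-- The closed cell of `x` in the subdivision into domains of linearity of `g`: the points at which
all monomials that are maximal at `x` are maximal. -/
def cell (x : Fin d → ℝ) : Set (Fin d → ℝ) :=
  {y | ∀ t ∈ g.terms, termEval t x = g.eval x → termEval t y = g.eval y}

theorem mem_cell_self (x : Fin d → ℝ) : x ∈ g.cell x := fun _ _ h => h

-- The subdivision of a product refines that of each factor.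
variable {g h} in
theorem cell_mul_subset (x : Fin d → ℝ) : (g * h).cell x ⊆ g.cell x := by
  intro y hy t ht hte
  obtain ⟨u, hu, hue⟩ := h.exists_termEval_eq_eval x
  exact ((termEval_add_eq_eval_mul_iff ht hu).1
    (hy (t + u) (Finset.add_mem_add ht hu) ((termEval_add_eq_eval_mul_iff ht hu).2 ⟨hte, hue⟩))).1

variable {g} in
theorem mem_hypersurface_of_mem_cell {x y : Fin d → ℝ} (hx : x ∈ g.hypersurface)
    (hy : y ∈ g.cell x) : y ∈ g.hypersurface := by
  obtain ⟨s, hs, t, ht, hne, hse, hte⟩ := hx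
  exact ⟨s, hs, t, ht, hne, hy s hs hse, hy t ht hte⟩

open Classical in
/-- Inequalities that define the cell of `x`. -/
noncomputable def cellIneqs (x : Fin d → ℝ) : Finset ((Fin d → ℝ) × ℝ) :=
  ((g.terms.filter fun t => termEval t x = g.eval x) ×ˢ g.terms).image
    fun p => (p.2.1 - p.1.1, p.1.2 - p.2.2)

theorem forall_mem_cellIneqs {x : Fin d → ℝ} {P : (Fin d → ℝ) × ℝ → Prop} :
    (∀ p ∈ g.cellIneqs x, P p) ↔ ∀ t ∈ g.terms, termEval t x = g.eval x → ∀ s ∈ g.terms,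
      P (s.1 - t.1, t.2 - s.2) := by
  classical
  simp only [cellIneqs, Finset.forall_mem_image, Finset.mem_product, Finset.mem_filter]
  exact ⟨fun H t ht hte s hs => @H (t, s) ⟨⟨ht, hte⟩, hs⟩,
    fun H p hp => H p.1 hp.1.1 hp.1.2 p.2 hp.2⟩

theorem sub_dotProduct_le_iff (s t : (Fin d → ℝ) × ℝ) (y : Fin d → ℝ) :
    (s.1 - t.1) ⬝ᵥ y ≤ t.2 - s.2 ↔ termEval s y ≤ termEval t y := by
  rw [sub_dotProduct, termEval, termEval]
  constructor <;> intro h <;> linarith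

theorem sub_dotProduct_eq_iff (s t : (Fin d → ℝ) × ℝ) (y : Fin d → ℝ) :
    (s.1 - t.1) ⬝ᵥ y = t.2 - s.2 ↔ termEval s y = termEval t y := by
  rw [sub_dotProduct, termEval, termEval]
  constructor <;> intro h <;> linarith

variable {g} in
theorem termEval_eq_eval_iff {t : (Fin d → ℝ) × ℝ} (ht : t ∈ g.terms) {y : Fin d → ℝ} :
    termEval t y = g.eval y ↔ ∀ s ∈ g.terms, termEval s y ≤ termEval t y := by
  refine ⟨fun h s hs => h ▸ termEval_le_eval hs y, fun h => ?_⟩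
  obtain ⟨s, hs, hse⟩ := g.exists_termEval_eq_eval y
  exact le_antisymm (termEval_le_eval ht y) (hse ▸ h s hs)

theorem cell_eq (x : Fin d → ℝ) : g.cell x = {y | ∀ p ∈ g.cellIneqs x, p.1 ⬝ᵥ y ≤ p.2} := by
  ext y
  simp only [cell, Set.mem_ofPred_eq, forall_mem_cellIneqs, sub_dotProduct_le_iff]
  exact forall₂_congr fun t ht => imp_congr_right fun _ => termEval_eq_eval_iff ht

theorem isPolyhedron_cell (x : Fin d → ℝ) : IsPolyhedron (g.cell x) := ⟨_, g.cell_eq x⟩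

variable {g} in
theorem cell_subset_cell {x y : Fin d → ℝ} (hy : y ∈ g.cell x) : g.cell y ⊆ g.cell x :=
  fun _ hz t ht hte => hz t ht (hy t ht hte)

/-- The nonempty faces of a cell are cells. -/
theorem exists_eq_cell_of_isExposed {x : Fin d → ℝ} {τ : Set (Fin d → ℝ)} (hne : τ.Nonempty)
    (hτ : IsExposed ℝ (g.cell x) τ) : ∃ z ∈ g.cell x, τ = g.cell z := by
  have hmem : ∀ {y}, y ∈ g.cell x → ∀ p ∈ g.cellIneqs x, p.1 ⬝ᵥ y ≤ p.2 := fun {y} hy => by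
    rw [cell_eq] at hy
    exact hy
  obtain ⟨z, hz, hmin⟩ := (hτ.convex (g.isPolyhedron_cell x).convex).exists_tight_imp_tight
    (g.cellIneqs x) hne fun y hy => hmem (hτ.subset hy)
  -- On the cell of `x`, the inequality of a pair `(t, s)` with `t` maximal at `x` is tight exactly
  -- where `s` is maximal.
  have htight : ∀ y ∈ g.cell x, (∀ p ∈ g.cellIneqs x, p.1 ⬝ᵥ z = p.2 → p.1 ⬝ᵥ y = p.2) ↔
      y ∈ g.cell z := by
    intro y hy
    simp only [forall_mem_cellIneqs, sub_dotProduct_eq_iff]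
    constructor
    · intro h s hs hse
      obtain ⟨t, ht, hte⟩ := g.exists_termEval_eq_eval x
      rw [h t ht hte s hs (hse.trans (hτ.subset hz t ht hte).symm)]
      exact hy t ht hte
    · intro h t ht hte s hs hst
      rw [h s hs (hst.trans (hτ.subset hz t ht hte)), hy t ht hte]
  refine ⟨z, hτ.subset hz, Set.Subset.antisymm
    (fun y hy => (htight y (hτ.subset hy)).1 (hmin y hy)) fun y hy => ?_⟩
  have hyx := cell_subset_cell (hτ.subset hz) hy
  -- The segment from `y` prolongs beyond `z` inside the cell of `x`, so the functional exposing
  -- `τ`, maximal at `z`, is maximal at `y` too.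
  obtain ⟨ε, hε, hw⟩ := exists_add_smul_sub_mem_of_tight (g.cellIneqs x) (hmem (hτ.subset hz))
    ((htight y hyx).2 hy)
  obtain ⟨l, rfl⟩ := hτ hne
  have hl := hz.2 (z + ε • (z - y)) (by rw [cell_eq]; exact hw)
  simp only [map_add, map_smul, map_sub, smul_eq_mul] at hl
  refine ⟨hyx, fun u hu => (hz.2 u hu).trans ?_⟩
  by_contra! h
  nlinarith

/-- Fix `t` maximal at `x` and sum `s - t` over the monomials `s` maximal at `y`. On the cell of `x`
this sum is nonpositive and, if the cells meet, vanishes exactly on the cell of `y`; its linear part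
exposes the intersection. -/
theorem isExposed_cell_inter_cell (x y : Fin d → ℝ) :
    IsExposed ℝ (g.cell x) (g.cell x ∩ g.cell y) := by
  classical
  rintro ⟨w, hwx, hwy⟩
  obtain ⟨t, ht, hte⟩ := g.exists_termEval_eq_eval x
  set T := g.terms.filter fun s => termEval s y = g.eval y with hT
  have hl : ∀ u, (∑ s ∈ T, dotFunctional (s.1 - t.1)) u =
      ∑ s ∈ T, (termEval s u - termEval t u) + ∑ s ∈ T, (t.2 - s.2) := by
    intro u
    rw [sum_apply, ← Finset.sum_add_distrib]
    refine Finset.sum_congr rfl fun s _ => ?_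
    rw [dotFunctional_apply, sub_dotProduct, termEval, termEval]
    ring
  have hnonpos : ∀ u ∈ g.cell x, ∀ s ∈ T, termEval s u - termEval t u ≤ 0 := fun u hu s hs => by
    rw [hu t ht hte, sub_nonpos]
    exact termEval_le_eval (Finset.mem_filter.1 hs).1 u
  have hzero : ∀ u ∈ g.cell x, u ∈ g.cell y → ∑ s ∈ T, (termEval s u - termEval t u) = 0 := by
    intro u hu huy
    refine Finset.sum_eq_zero fun s hs => ?_
    rw [huy s (Finset.mem_filter.1 hs).1 (Finset.mem_filter.1 hs).2, hu t ht hte, sub_self]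
  refine ⟨∑ s ∈ T, dotFunctional (s.1 - t.1), Set.ext fun u => ⟨?_, ?_⟩⟩
  · rintro ⟨hux, huy⟩
    refine ⟨hux, fun v hv => ?_⟩
    rw [hl, hl, hzero u hux huy]
    exact add_le_add_left (Finset.sum_nonpos (hnonpos v hv)) _
  · rintro ⟨hux, hu⟩
    refine ⟨hux, fun s hs hse => ?_⟩
    have h1 := hu w hwx
    rw [hl, hl, hzero w hwx hwy] at h1
    have h2 : ∑ s ∈ T, (termEval s u - termEval t u) = 0 :=
      le_antisymm (Finset.sum_nonpos (hnonpos u hux)) (by linarith)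
    have h3 := (Finset.sum_eq_zero_iff_of_nonpos (hnonpos u hux)).1 h2 s
      (Finset.mem_filter.2 ⟨hs, hse⟩)
    rw [← hux t ht hte]
    linarith

theorem finite_range_cell : (Set.range g.cell).Finite := by
  classical
  refine (g.terms.powerset.finite_toSet.image fun T =>
    {y | ∀ t ∈ T, termEval t y = g.eval y}).subset ?_
  rintro _ ⟨x, rfl⟩
  refine ⟨g.terms.filter fun t => termEval t x = g.eval x, Finset.mem_coe.2 (Finset.mem_powerset.2 (Finset.filter_subset _ _)), ?_⟩
  ext y
  simp [cell]

/-- The cells of `g` that are contained in a union `Z` of cells form a polyhedral complex. -/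
noncomputable def cellComplex (Z : Set (Fin d → ℝ)) (hZ : ∀ x ∈ Z, g.cell x ⊆ Z) : PolyhedralComplex d where
  cells := (g.finite_range_cell.subset (Set.image_subset_range g.cell Z)).toFinset
  cell_nonempty := by
    simp only [Set.Finite.mem_toFinset, Set.forall_mem_image]
    exact fun x _ => ⟨x, g.mem_cell_self x⟩
  cell_isPolyhedron := by
    simp only [Set.Finite.mem_toFinset, Set.forall_mem_image]
    exact fun x _ => g.isPolyhedron_cell x
  face_mem := by
    simp only [Set.Finite.mem_toFinset, Set.forall_mem_image]
    intro x hx τ hne hτ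
    obtain ⟨z, hz, rfl⟩ := g.exists_eq_cell_of_isExposed hne hτ
    exact Set.mem_image_of_mem _ (hZ x hx hz)
  inter_isFace := by
    simp only [Set.Finite.mem_toFinset, Set.forall_mem_image]
    intro x _ y _
    exact ⟨g.isExposed_cell_inter_cell x y, Set.inter_comm _ _ ▸ g.isExposed_cell_inter_cell y x⟩

theorem support_cellComplex (Z : Set (Fin d → ℝ)) (hZ : ∀ x ∈ Z, g.cell x ⊆ Z) :
    (g.cellComplex Z hZ).support = Z := by
  simp only [PolyhedralComplex.support, cellComplex, Set.Finite.mem_toFinset, Set.biUnion_image]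
  exact Set.Subset.antisymm (Set.iUnion₂_subset hZ)
    fun x hx => Set.mem_biUnion hx (g.mem_cell_self x)

end TropicalSignomial

/-! ### Inclusion-exclusion and the counting formula -/

theorem exists_polyhedralComplex_support_eq_iInter {d m : ℕ} (g : Fin m → TropicalSignomial d)
    (S : Finset (Fin m)) :
    ∃ K : PolyhedralComplex d, K.support = ⋂ i ∈ S, (g i).hypersurface := by
  classical
  refine ⟨(∏ i, g i).cellComplex _ fun x hx y hy => ?_, TropicalSignomial.support_cellComplex _ _ _⟩
  rw [Set.mem_iInter₂] at hx ⊢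
  intro i hi
  refine TropicalSignomial.mem_hypersurface_of_mem_cell (hx i hi) ?_
  rw [← Finset.mul_prod_erase _ _ (Finset.mem_univ i)] at hy
  exact TropicalSignomial.cell_mul_subset x hy

theorem sum_nonempty_powerset_eq {m : ℕ} (f : Finset (Fin m) → ℤ) :
    ∑ S ∈ (Finset.univ : Finset (Fin m)).powerset with S.Nonempty, f S =
      ∑ i, f {i} + ∑ k ∈ Finset.Icc 2 m, ∑ S ∈ Finset.powersetCard k Finset.univ, f S := by
  classical
  have h1 : ∀ S ∈ (Finset.univ : Finset (Fin m)).powerset.filter Finset.Nonempty,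
      S.card ∈ Finset.Icc 1 m := fun S hS => by
    rw [Finset.mem_Icc, Nat.one_le_iff_ne_zero, Finset.card_ne_zero]
    exact ⟨(Finset.mem_filter.1 hS).2, (Finset.card_le_univ S).trans_eq (Fintype.card_fin m)⟩
  have h2 : ∀ k ∈ Finset.Icc 1 m,
      ((Finset.univ : Finset (Fin m)).powerset.filter Finset.Nonempty).filter (fun S => S.card = k) =
        Finset.powersetCard k Finset.univ := fun k hk => by
    ext S
    simp only [Finset.mem_filter, Finset.mem_powerset, Finset.mem_powersetCard, Finset.subset_univ,
      true_and, and_iff_right_iff_imp]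
    intro h
    rw [← Finset.card_pos, h]
    exact (Finset.mem_Icc.1 hk).1
  rw [← Finset.sum_fiberwise_of_maps_to h1, Finset.sum_congr rfl fun k hk => by rw [h2 k hk]]
  rcases m.eq_zero_or_pos with rfl | hm
  · simp
  · rw [← Finset.insert_Icc_add_one_left_eq_Icc (show 1 ≤ m from hm), Finset.sum_insert (by simp),
      Finset.powersetCard_one, Finset.sum_map]
    rfl

theorem mlen_prod_eq {d m : ℕ} (g : Fin m → TropicalSignomial d)
    (K : Finset (Fin m) → PolyhedralComplex d)
    (hK : ∀ S : Finset (Fin m), 2 ≤ S.card → (K S).support = ⋂ i ∈ S, (g i).hypersurface) :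
    ((∏ i, g i).mlen : ℤ) = TropicalSignomial.flen g +
      ∑ k ∈ Finset.Icc 2 m, (-1) ^ (k + d) *
        ∑ S ∈ Finset.powersetCard k (Finset.univ : Finset (Fin m)), (K S).eulerChar := by
  classical
  have hex : ∀ S : Finset (Fin m), ∃ n : ℤ, S.Nonempty →
      ((⋂ i ∈ S, (g i).hypersurface).indicator 1, n) ∈ eulerGraph (Fin d → ℝ) := by
    intro S
    obtain ⟨L, hL⟩ := exists_polyhedralComplex_support_eq_iInter g S
    exact ⟨L.eulerChar, fun _ => hL ▸ L.mem_eulerGraph⟩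
  -- These values do not come from `K`, which is unconstrained on singletons.
  choose χ hχ using hex
  have hχ1 : ∀ i, χ {i} = (-1) ^ d * (1 - ((g i).mlen : ℤ)) := fun i =>
    eq_of_mem_eulerGraph (by simpa using hχ {i} (Finset.singleton_nonempty i))
      (g i).hypersurface_mem_eulerGraph
  have hχ2 : ∀ S : Finset (Fin m), 2 ≤ S.card → χ S = (K S).eulerChar := fun S hS =>
    eq_of_mem_eulerGraph (hχ S (Finset.card_pos.1 (by omega))) (hK S hS ▸ (K S).mem_eulerGraph)
  have hsum : ((∏ i, g i).hypersurface.indicator 1,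
      ∑ S ∈ (Finset.univ : Finset (Fin m)).powerset with S.Nonempty, (-1 : ℤ) ^ (S.card + 1) * χ S) ∈
        eulerGraph (Fin d → ℝ) := by
    convert Submodule.sum_mem (eulerGraph (Fin d → ℝ)) fun S
      (hS : S ∈ (Finset.univ : Finset (Fin m)).powerset.filter Finset.Nonempty) =>
      Submodule.smul_mem _ ((-1 : ℤ) ^ (S.card + 1)) (hχ S (Finset.mem_filter.1 hS).2) using 1
    refine Prod.ext ?_ ?_
    · funext x
      simp only [TropicalSignomial.hypersurface_prod, Finset.indicator_biUnion_eq_sum_powerset,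
        Prod.fst_sum, Finset.sum_apply]
      rfl
    · simp only [Prod.snd_sum]
      rfl
  -- Two evaluations of χ on the union: through its regions and through inclusion-exclusion.
  have h := eq_of_mem_eulerGraph (∏ i, g i).hypersurface_mem_eulerGraph hsum
  rw [sum_nonempty_powerset_eq] at h
  have h1 : ∑ i, ((-1 : ℤ) ^ (({i} : Finset (Fin m)).card + 1) * χ {i}) =
      (-1) ^ d * (m - ∑ i, ((g i).mlen : ℤ)) := by
    simp [hχ1, ← Finset.mul_sum]
  have h2 : ∑ k ∈ Finset.Icc 2 m, ∑ S ∈ Finset.powersetCard k (Finset.univ : Finset (Fin m)),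
      ((-1 : ℤ) ^ (S.card + 1) * χ S) = (-1) ^ d * -∑ k ∈ Finset.Icc 2 m, (-1) ^ (k + d) *
        ∑ S ∈ Finset.powersetCard k (Finset.univ : Finset (Fin m)), (K S).eulerChar := by
    rw [← Finset.sum_neg_distrib, Finset.mul_sum]
    refine Finset.sum_congr rfl fun k hk => ?_
    have hsq : (-1 : ℤ) ^ d * (-1) ^ d = 1 := by rw [← pow_add, Even.neg_one_pow ⟨d, rfl⟩]
    have : (-1 : ℤ) ^ d * -((-1) ^ (k + d) *
        ∑ S ∈ Finset.powersetCard k (Finset.univ : Finset (Fin m)), (K S).eulerChar) =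
        (-1) ^ (k + 1) *
          ∑ S ∈ Finset.powersetCard k (Finset.univ : Finset (Fin m)), (K S).eulerChar := by
      rw [pow_add, pow_add, pow_one]
      linear_combination (-(-1) ^ k *
        ∑ S ∈ Finset.powersetCard k (Finset.univ : Finset (Fin m)), (K S).eulerChar) * hsq
    rw [this, Finset.mul_sum]
    refine Finset.sum_congr rfl fun S hS => ?_
    have hc := (Finset.mem_powersetCard.1 hS).2
    rw [hχ2 S (hc ▸ (Finset.mem_Icc.1 hk).1), hc]
  rw [h1, h2, ← mul_add] at h
  have h := mul_left_cancel₀ (pow_ne_zero d (by norm_num)) h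
  rw [TropicalSignomial.flen]
  linarith

theorem mainTheorem3 (d m : ℕ) (g : Fin m → TropicalSignomial d) :
    -- the number of regions of the arrangement is the monomial length of the product
    Nat.card (ConnectedComponents ↥(⋃ i, (g i).hypersurface)ᶜ) = (∏ i, g i).mlen ∧
    -- the intersections of the hypersurfaces are finite polyhedral complexes
    (∀ S : Finset (Fin m), S.Nonempty →
      ∃ K : PolyhedralComplex d, K.support = ⋂ i ∈ S, (g i).hypersurface) ∧
    -- the counting formula, whatever complexes are used to compute the Euler characteristics
    ∀ K : Finset (Fin m) → PolyhedralComplex d,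
      (∀ S : Finset (Fin m), 2 ≤ S.card → (K S).support = ⋂ i ∈ S, (g i).hypersurface) →
      ((∏ i, g i).mlen : ℤ) = TropicalSignomial.flen g +
        ∑ k ∈ Finset.Icc 2 m, (-1) ^ (k + d) *
          ∑ S ∈ Finset.powersetCard k (Finset.univ : Finset (Fin m)), (K S).eulerChar := by
  refine ⟨?_, fun S _ => exists_polyhedralComplex_support_eq_iInter g S, mlen_prod_eq g⟩
  have h : ⋃ i, (g i).hypersurface = (∏ i, g i).hypersurface := by
    simp [TropicalSignomial.hypersurface_prod]
  rw [h, TropicalSignomial.card_connectedComponents]
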